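/- Write $\mathbb{N}=\{1,2,3,\dots\}$ and $[N]=\{1,\dots,N\}$. Let $S$ be the shift $(Sx)(i)=x(i+1)$ on $\{0,1\}^{\mathbb{N}}$. A set $\mathcal{A}\subset\mathbb{N}$ is called weakly mixing if it has positive upper density and its characteristic function $1_{\mathcal{A}}$, as a point of the orbit closure $X_{\mathcal{A}}=\overline{\{S^n 1_{\mathcal{A}} : n\ge 0\}}\subset\{0,1\}^{\mathbb{N}}$, is generic for an ergodic $S$-invariant Borel probability measure $\mu$ on $X_{\mathcal{A}}$ (that is, $\frac1N\sum_{n=1}^N f(S^n1_{\mathcal{A}})\to\int f\,d\mu$ for every continuous $f\colon X_{\mathcal{A}}\to\mathbb{R}$) such that $(X_{\mathcal{A}},S,\mu)$ is weakly mixing (that is, $\frac1N\sum_{n=1}^N|\mu(E\cap S^{-n}F)-\mu(E)\mu(F)|\to0$ for all Borel $E,F\subset X_{\mathcal{A}}$). **Theorem 1.7.** Let $\mathcal{A}\subset\mathbb{N}$ be a weakly mixing set, and let $\mathcal{B}\subset\mathbb{N}$ be a set of positive density, i.e. $\lim_{N\to\infty}|\mathcal{B}\cap[N]|/N$ exists and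 is positive. Let $p_i^{(N)}(x)\in\mathbb{Z}[x]$, for $i\in[r]$ and $N\in\mathbb{N}$, be a family of polynomials which is uniformly admissible, i.e. 1. for each $i$ and $N$, $\deg p_i^{(N)}>0$ and the leading coefficient of $p_i^{(N)}$ is positive, and moreover this degree and leading coefficient are independent of $N$; 2. for each $i\neq j$ and each $N$, $\deg(p_i^{(N)}-p_j^{(N)})>0$, and moreover the degree and the leading coefficient of $p_i^{(N)}-p_j^{(N)}$ are independent of $N$. Then there exists $N_0$ such that for every $N>N_0$ there are $n\in\mathbb{N}$ with $n\le N$ and $m\in\mathcal{B}$ such that $p_1^{(N)}(n)+m,\dots,p_r^{(N)}(n)+m\in\mathcal{A}$. -/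

import Mathlib

open MeasureTheory Filter Topology Polynomial

/-! Throughout, the natural numbers `1, 2, 3, …` are the type `ℕ+`. -/

/-- The proportion of the elements of `{1, …, N}` which lie in `A`. -/
noncomputable def densityUpTo (A : Set ℕ+) (N : ℕ) : ℝ :=
  ({a ∈ A | (a : ℕ) ≤ N}.ncard : ℝ) / N

/-- `A` has density `d`: the limit of `|A ∩ [N]| / N` exists and equals `d`. -/
def HasNatDensity (A : Set ℕ+) (d : ℝ) : Prop :=
  Tendsto (densityUpTo A) atTop (𝓝 d)

/-- `A` has positive density (in particular, the density exists). -/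
def HasPosDensity (A : Set ℕ+) : Prop :=
  ∃ d : ℝ, 0 < d ∧ HasNatDensity A d

/-- The upper density of a set of positive integers. -/
noncomputable def upperNatDensity (A : Set ℕ+) : ℝ :=
  limsup (densityUpTo A) atTop

/-- A map `T` is weakly mixing for the measure `μ`: for all measurable `E`, `F`, the averages
of `|μ(E ∩ T⁻ⁿ F) - μ(E) μ(F)|` over `1 ≤ n ≤ N` tend to `0`. (That `T` preserves the probability
measure `μ` is required separately.) -/
def IsWeaklyMixing {X : Type*} [MeasurableSpace X] (T : X → X) (μ : Measure X) : Prop :=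
  ∀ E F : Set X, MeasurableSet E → MeasurableSet F →
    Tendsto
      (fun N : ℕ => (∑ n ∈ Finset.Icc 1 N,
        |μ.real (E ∩ T^[n] ⁻¹' F) - μ.real E * μ.real F|) / (N : ℝ))
      atTop (𝓝 0)

/-- The point `x` is generic for `(X, T, μ)`: the ergodic averages of every continuous function
along the orbit of `x` tend to its integral. -/
def IsErgodicGeneric {X : Type*} [TopologicalSpace X] [MeasurableSpace X] (T : X → X)
    (μ : Measure X) (x : X) : Prop :=
  ∀ f : C(X, ℝ),
    Tendsto (fun N : ℕ => (∑ n ∈ Finset.Icc 1 N, f (T^[n] x)) / (N : ℝ)) atTop (𝓝 (∫ y, f y ∂μ))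

/-- The shift space `{0, 1}^ℕ`, with the product topology and its Borel `σ`-algebra. -/
abbrev ShiftSpace : Type := ℕ+ → Bool

/-- The shift map, `(S x)(i) = x(i + 1)`. -/
def shiftMap (x : ShiftSpace) : ShiftSpace := fun i => x (i + 1)

theorem continuous_shiftMap : Continuous shiftMap :=
  continuous_pi fun i => continuous_apply (i + 1)

open Classical in
/-- The characteristic function of `A`, as a point of the shift space. -/
noncomputable def charPoint (A : Set ℕ+) : ShiftSpace := fun i => decide (i ∈ A)

/-- The subshift of `A`: the orbit closure of the characteristic function of `A`. -/
def subshift (A : Set ℕ+) : Set ShiftSpace :=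
  closure (Set.range fun n : ℕ => shiftMap^[n] (charPoint A))

theorem charPoint_mem_subshift (A : Set ℕ+) : charPoint A ∈ subshift A :=
  subset_closure ⟨0, rfl⟩

theorem mapsTo_shiftMap_subshift (A : Set ℕ+) :
    Set.MapsTo shiftMap (subshift A) (subshift A) := by
  refine Set.MapsTo.closure ?_ continuous_shiftMap
  rintro _ ⟨n, rfl⟩
  exact ⟨n + 1, Function.iterate_succ_apply' _ _ _⟩

/-- The shift map on the subshift of `A`. -/
def subshiftMap (A : Set ℕ+) : subshift A → subshift A :=
  (mapsTo_shiftMap_subshift A).restrict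

/-- `A` is weakly mixing: it has positive upper density, and its characteristic function is, in
the subshift of `A`, generic for an ergodic shift-invariant Borel probability measure (which is
unique) for which the shift is weakly mixing. -/
def IsWeaklyMixingSet (A : Set ℕ+) : Prop :=
  0 < upperNatDensity A ∧
    ∃ μ : Measure (subshift A), IsProbabilityMeasure μ ∧ Ergodic (subshiftMap A) μ ∧
      IsErgodicGeneric (subshiftMap A) μ ⟨charPoint A, charPoint_mem_subshift A⟩ ∧
      IsWeaklyMixing (subshiftMap A) μ

/-- Uniform admissibility of a family `p i N` of integer polynomials (`natDegree` agrees with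
the degree here, the degrees being positive). -/
structure IsUniformlyAdmissible {r : ℕ} (p : Fin r → ℕ+ → ℤ[X]) : Prop where
  natDegree_pos : ∀ i N, 0 < (p i N).natDegree
  leadingCoeff_pos : ∀ i N, 0 < (p i N).leadingCoeff
  natDegree_eq : ∀ i N N', (p i N).natDegree = (p i N').natDegree
  leadingCoeff_eq : ∀ i N N', (p i N).leadingCoeff = (p i N').leadingCoeff
  natDegree_sub_pos : ∀ i j, i ≠ j → ∀ N, 0 < (p i N - p j N).natDegree
  natDegree_sub_eq : ∀ i j, i ≠ j → ∀ N N',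
    (p i N - p j N).natDegree = (p i N' - p j N').natDegree
  leadingCoeff_sub_eq : ∀ i j, i ≠ j → ∀ N N',
    (p i N - p j N).leadingCoeff = (p i N' - p j N').leadingCoeff

/-!
Let `f` be the characteristic function of `A`, extended by zero to `ℤ`. Genericity of `A` says that
the functions on `ℤ` obtained from `f` by translations, sums and products have averages along `ℕ`,
given by integrals against `μ`. With this average as an invariant positive functional, and with
translations as an invertible action of `ℤ` (although the shift on the subshift of `A` need not be
invertible), these functions form a weakly mixing system; see `MixingSystem` and
`observablesSystem`. The mean of `f` is the upper density `d > 0` of `A`.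

In such a system the averages over `n ≤ N` of `∏ i, f (m + p i N n)`, as functions of `m`, converge
to `d ^ r` in mean square: this is `MixingSystem.isNull_deviation`. If for some large `N` there were
no `n ≤ N` and `m ∈ B` with all of `m + p i N n` in `A`, then this average would be zero for all
`m ∈ B`, and its mean square distance to `d ^ r` would be at least `d ^ (2 * r)` times the density
of `B`, a contradiction.

The convergence is proved by the polynomial exhaustion technique of Bergelson. One may suppose that
one of the observables has mean zero. Van der Corput's lemma (`MixingSystem.van_der_corput`) passes
to the correlations at a fixed lag `h`, hence to the family of all `p i` and all `p i (X + h)`, and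
invariance allows a member of minimal degree to be subtracted from all the others. The resulting
family is simpler: the multiset of degrees of the distinct leading terms decreases in the
Dershowitz–Manna ordering (`IsAdmissible.exists_sub_weight_lt`). As `h` stays fixed while `N` grows,
and only leading terms matter for the induction, the dependence of the lower coefficients on `N` is
harmless. Weak mixing itself is used only for linear members of the family.
-/

/-! ### Van der Corput's lemma -/

/-- An algebraic stand-in for an invertible weakly mixing system: a normed algebra `R` of
observables, with an action of `ℤ` by contractive algebra endomorphisms and an invariant positive
functional `mean` such that the autocorrelations of mean zero observables are small on average.
The measure is only seen through `mean`, which need not be definite, so that `R` may consist of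
functions on `ℤ` with `mean` the averages along `ℕ`; the action of `ℤ` is invertible even where
the underlying dynamics is not. -/
structure MixingSystem (R : Type*) [NormedCommRing R] [NormedAlgebra ℝ R] where
  shift : ℤ → R →ₐ[ℝ] R
  mean : R →ₗ[ℝ] ℝ
  shift_zero : ∀ f, shift 0 f = f
  shift_add : ∀ k l f, shift (k + l) f = shift k (shift l f)
  norm_shift_le : ∀ k f, ‖shift k f‖ ≤ ‖f‖
  mean_one : mean 1 = 1
  mean_shift : ∀ k f, mean (shift k f) = mean f
  mean_mul_self_nonneg : ∀ f, 0 ≤ mean (f * f)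
  abs_mean_le : ∀ f, |mean f| ≤ ‖f‖
  tendsto_correlation : ∀ f, mean f = 0 →
    Tendsto (fun H : ℕ => (H : ℝ)⁻¹ * ∑ h ∈ Finset.range H, |mean (f * shift h f)|) atTop (𝓝 0)

theorem norm_sum_range_add_sub_le {E : Type*} [SeminormedAddCommGroup E] {v : ℕ → E} {C : ℝ}
    (hv : ∀ n, ‖v n‖ ≤ C) (N h : ℕ) :
    ‖∑ n ∈ Finset.range N, v (n + h) - ∑ n ∈ Finset.range N, v n‖ ≤ 2 * h * C := by
  have h1 : ∑ n ∈ Finset.range N, v (n + h) - ∑ n ∈ Finset.range N, v n =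
      ∑ x ∈ Finset.range h, v (N + x) - ∑ x ∈ Finset.range h, v x := by
    have e1 := Finset.sum_range_add v N h
    have e2 := Finset.sum_range_add v h N
    rw [add_comm h N, e1] at e2
    simp only [add_comm _ h]
    rw [sub_eq_sub_iff_add_eq_add, add_comm, ← e2, add_comm]
  have hb : ∀ w : ℕ → E, (∀ n, ‖w n‖ ≤ C) → ‖∑ x ∈ Finset.range h, w x‖ ≤ h * C := by
    intro w hw
    simpa using norm_sum_le_of_le (Finset.range h) (fun x _ => hw x)
  rw [h1]
  calc _ ≤ _ := norm_sub_le _ _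
    _ ≤ h * C + h * C := add_le_add (hb _ fun n => hv _) (hb _ hv)
    _ = _ := by ring

/-- Each distance below `H` occurs at most twice in each row of the `H × H` square. -/
theorem sum_sum_dist_le {γ : ℕ → ℝ} (hγ : ∀ h, 0 ≤ γ h) (H : ℕ) :
    ∑ h ∈ Finset.range H, ∑ k ∈ Finset.range H, γ (Nat.dist h k) ≤
      2 * H * ∑ j ∈ Finset.range H, γ j := by
  have key : ∀ h ∈ Finset.range H, ∑ k ∈ Finset.range H, γ (Nat.dist h k) ≤
      2 * ∑ j ∈ Finset.range H, γ j := by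
    intro h hh
    rw [Finset.mem_range] at hh
    rw [← Finset.sum_filter_add_sum_filter_not _ (fun k => k ≤ h), two_mul]
    have sub : ∀ s : Finset ℕ, s ⊆ Finset.range H → Set.InjOn (Nat.dist h) s →
        ∑ k ∈ s, γ (Nat.dist h k) ≤ ∑ j ∈ Finset.range H, γ j := by
      intro s hs hinj
      rw [← Finset.sum_image (f := γ) hinj]
      refine Finset.sum_le_sum_of_subset_of_nonneg ?_ fun _ _ _ => hγ _
      intro j hj
      obtain ⟨k, hk, rfl⟩ := Finset.mem_image.1 hj
      have := Finset.mem_range.1 (hs hk)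
      simp only [Nat.dist, Finset.mem_range]
      omega
    refine add_le_add (sub _ (Finset.filter_subset _ _) ?_) (sub _ (Finset.filter_subset _ _) ?_)
    all_goals
      intro a ha b hb hab
      simp only [Finset.coe_filter, Set.mem_ofPred_eq, Nat.dist] at ha hb hab
      omega
  calc _ ≤ ∑ h ∈ Finset.range H, 2 * ∑ j ∈ Finset.range H, γ j := Finset.sum_le_sum key
    _ = _ := by simp; ring

namespace MixingSystem

variable {R : Type*} [NormedCommRing R] [NormedAlgebra ℝ R] (W : MixingSystem R)

theorem mean_add_mul_self_le (f g : R) :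
    W.mean ((f + g) * (f + g)) ≤ 2 * W.mean (f * f) + 2 * W.mean (g * g) := by
  have h := W.mean_mul_self_nonneg (f - g)
  have e : (f + g) * (f + g) = f * f + f * f + (g * g + g * g) - (f - g) * (f - g) := by ring
  rw [e]
  simp only [map_sub, map_add]
  linarith

theorem mean_mul_self_le_norm_sq (f : R) : W.mean (f * f) ≤ ‖f‖ ^ 2 :=
  (le_abs_self _).trans <| (W.abs_mean_le _).trans <| (norm_mul_le _ _).trans_eq (sq _).symm

theorem mean_mul_sq_le (f g : R) :
    W.mean (f * g) ^ 2 ≤ W.mean (f * f) * W.mean (g * g) := by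
  have h : ∀ t : ℝ, 0 ≤ W.mean (f * f) * (t * t) + 2 * W.mean (f * g) * t + W.mean (g * g) := by
    intro t
    have := W.mean_mul_self_nonneg (t • f + g)
    have e : (t • f + g) * (t • f + g) = (t * t) • (f * f) + (2 * t) • (f * g) + g * g := by
      simp only [Algebra.smul_def, map_mul, map_ofNat]; ring
    rw [e] at this
    simp only [map_add, map_smul, smul_eq_mul] at this
    linarith
  have := discrim_le_zero h
  simp only [discrim] at this
  nlinarith

theorem mean_average_mul_self_le (w : ℕ → R) {N : ℕ} (hN : 0 < N) :
    W.mean (((N : ℝ)⁻¹ • ∑ n ∈ Finset.range N, w n) * ((N : ℝ)⁻¹ • ∑ n ∈ Finset.range N, w n)) ≤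
      (N : ℝ)⁻¹ * ∑ n ∈ Finset.range N, W.mean (w n * w n) := by
  have hN' : (0 : ℝ) < N := by exact_mod_cast hN
  set b := (N : ℝ)⁻¹ • ∑ n ∈ Finset.range N, w n with hb
  have hsum : ∑ n ∈ Finset.range N, w n = (N : ℝ) • b := by
    rw [hb, smul_smul, mul_inv_cancel₀ hN'.ne', one_smul]
  have h0 : 0 ≤ ∑ n ∈ Finset.range N, W.mean ((w n - b) * (w n - b)) :=
    Finset.sum_nonneg fun n _ => W.mean_mul_self_nonneg _
  have e : ∑ n ∈ Finset.range N, W.mean ((w n - b) * (w n - b)) =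
      ∑ n ∈ Finset.range N, W.mean (w n * w n) - N * W.mean (b * b) := by
    have : ∀ n, (w n - b) * (w n - b) = w n * w n - (w n * b + w n * b - b * b) := fun n => by ring
    simp only [this, map_sub, map_add, Finset.sum_sub_distrib, Finset.sum_add_distrib]
    rw [← map_sum W.mean (fun n => w n * b), ← Finset.sum_mul, hsum]
    simp
  rw [e] at h0
  rw [inv_mul_eq_div, le_div_iff₀ hN']
  linarith

theorem average_correlation_le {u : ℕ → R} {C : ℝ} (hu : ∀ n, ‖u n‖ ≤ C) (N : ℕ) (h k : ℕ) :
    (N : ℝ)⁻¹ * ∑ n ∈ Finset.range N, W.mean (u (n + h) * u (n + k)) ≤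
      (N : ℝ)⁻¹ * ∑ n ∈ Finset.range N, W.mean (u n * u (n + Nat.dist h k)) +
        (N : ℝ)⁻¹ * (2 * (h + k) * C ^ 2) := by
  wlog hk : h ≤ k generalizing h k
  · have := this k h (by omega)
    rw [Nat.dist_comm, add_comm (k : ℝ)] at this
    simpa only [mul_comm] using this
  have hC : 0 ≤ C := (norm_nonneg _).trans (hu 0)
  have hv : ∀ n, ‖W.mean (u n * u (n + Nat.dist h k))‖ ≤ C ^ 2 := fun n => by
    rw [Real.norm_eq_abs, sq]
    exact (W.abs_mean_le _).trans <| (norm_mul_le _ _).trans <|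
      mul_le_mul (hu _) (hu _) (norm_nonneg _) hC
  have h1 := norm_sum_range_add_sub_le hv N h
  have h2 := (le_abs_self _).trans h1
  have e : ∀ n, n + h + Nat.dist h k = n + k := fun n => by simp only [Nat.dist]; omega
  simp only [e] at h2
  rw [← mul_add]
  gcongr
  have : 0 ≤ (k : ℝ) * C ^ 2 := by positivity
  linarith

/-- **Van der Corput's lemma**, for triangular arrays: if the averaged correlations of `u N n` and
`u N (n + h)` are asymptotically at most `γ h`, and `γ` tends to zero on average, then the averages
of `u N` tend to zero in mean square. The lag `h` is fixed while `N` grows, which makes the lemma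
fit for sequences that vary with `N`. -/
theorem van_der_corput {u : ℕ → ℕ → R} {C : ℝ} (hu : ∀ N n, ‖u N n‖ ≤ C) {γ : ℕ → ℝ}
    (hγ0 : ∀ h, 0 ≤ γ h)
    (hγ : ∀ h, ∀ ε > 0, ∀ᶠ N : ℕ in atTop,
      (N : ℝ)⁻¹ * ∑ n ∈ Finset.range N, W.mean (u N n * u N (n + h)) ≤ γ h + ε)
    (hγlim : Tendsto (fun H : ℕ => (H : ℝ)⁻¹ * ∑ h ∈ Finset.range H, γ h) atTop (𝓝 0)) :
    Tendsto (fun N : ℕ => W.mean (((N : ℝ)⁻¹ • ∑ n ∈ Finset.range N, u N n) *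
      ((N : ℝ)⁻¹ • ∑ n ∈ Finset.range N, u N n))) atTop (𝓝 0) := by
  have hC : 0 ≤ C := (norm_nonneg _).trans (hu 0 0)
  rw [Metric.tendsto_atTop']
  suffices key : ∀ ε > 0, ∀ᶠ N : ℕ in atTop, W.mean (((N : ℝ)⁻¹ • ∑ n ∈ Finset.range N, u N n) *
      ((N : ℝ)⁻¹ • ∑ n ∈ Finset.range N, u N n)) ≤ 10 * ε by
    intro ε hε
    obtain ⟨N₀, hN₀⟩ := eventually_atTop.1 (key (ε / 20) (by positivity))
    refine ⟨N₀, fun N hN => ?_⟩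
    rw [Real.dist_0_eq_abs, abs_of_nonneg (W.mean_mul_self_nonneg _)]
    linarith [hN₀ N hN.le]
  intro ε hε
  obtain ⟨H, hHε, hH⟩ := ((hγlim.eventually_lt_const hε).and (eventually_gt_atTop 0)).exists
  have hH' : (0 : ℝ) < H := by exact_mod_cast hH
  have ev1 : ∀ᶠ N : ℕ in atTop, ∀ j ∈ Finset.range H,
      (N : ℝ)⁻¹ * ∑ n ∈ Finset.range N, W.mean (u N n * u N (n + j)) ≤ γ j + ε :=
    (Finset.eventually_all _).2 fun j _ => hγ j ε hε
  have ev2 : ∀ᶠ N : ℕ in atTop, (N : ℝ)⁻¹ * (2 * (H + H) * C ^ 2) ≤ ε := by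
    have : Tendsto (fun N : ℕ => (N : ℝ)⁻¹ * (2 * (H + H) * C ^ 2)) atTop (𝓝 0) := by
      simpa using tendsto_inv_atTop_nhds_zero_nat (𝕜 := ℝ) |>.mul_const (2 * (H + H) * C ^ 2)
    exact (this.eventually_lt_const hε).mono fun _ h => h.le
  have ev3 : ∀ᶠ N : ℕ in atTop, 2 * ((N : ℝ)⁻¹ * (2 * H * C)) ^ 2 ≤ ε := by
    have : Tendsto (fun N : ℕ => 2 * ((N : ℝ)⁻¹ * (2 * H * C)) ^ 2) atTop (𝓝 0) := by
      simpa using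
        ((tendsto_inv_atTop_nhds_zero_nat (𝕜 := ℝ) |>.mul_const (2 * H * C)).pow 2).const_mul 2
    exact (this.eventually_lt_const hε).mono fun _ h => h.le
  filter_upwards [ev1, ev2, ev3, eventually_gt_atTop 0] with N h1 h2 h3 hN
  have hN' : (0 : ℝ) < N := by exact_mod_cast hN
  set a := (N : ℝ)⁻¹ • ∑ n ∈ Finset.range N, u N n with ha
  -- Averaging over a window of length `H` changes the average over `n < N` only at the ends.
  set w : ℕ → R := fun n => (H : ℝ)⁻¹ • ∑ h ∈ Finset.range H, u N (n + h) with hw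
  set b := (N : ℝ)⁻¹ • ∑ n ∈ Finset.range N, w n with hb
  have hab : ‖a - b‖ ≤ (N : ℝ)⁻¹ * (2 * H * C) := by
    have e : a - b = (N : ℝ)⁻¹ • (H : ℝ)⁻¹ • ∑ h ∈ Finset.range H,
        (∑ n ∈ Finset.range N, u N n - ∑ n ∈ Finset.range N, u N (n + h)) := by
      rw [Finset.sum_sub_distrib, smul_sub, smul_sub, ha, hb, hw]
      congr 1
      · rw [Finset.sum_const, Finset.card_range, ← Nat.cast_smul_eq_nsmul ℝ, smul_smul (H : ℝ)⁻¹,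
          inv_mul_cancel₀ hH'.ne', one_smul]
      · rw [← Finset.smul_sum, Finset.sum_comm]
    rw [e, norm_smul, norm_smul, norm_inv, norm_inv, RCLike.norm_natCast, RCLike.norm_natCast]
    refine mul_le_mul_of_nonneg_left ?_ (by positivity)
    rw [inv_mul_le_iff₀ hH']
    refine (norm_sum_le_of_le _ (n := fun _ => 2 * H * C) fun h hh => ?_).trans (by simp)
    rw [norm_sub_rev]
    refine (norm_sum_range_add_sub_le (hu N) N h).trans ?_
    have : (h : ℝ) ≤ H := by exact_mod_cast (Finset.mem_range.1 hh).le
    gcongr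
  have hA : W.mean (a * a) ≤ 2 * W.mean (b * b) + ε := by
    have e1 := W.mean_add_mul_self_le b (a - b)
    rw [add_sub_cancel] at e1
    have e2 := W.mean_mul_self_le_norm_sq (a - b)
    have e3 : ‖a - b‖ ^ 2 ≤ ((N : ℝ)⁻¹ * (2 * H * C)) ^ 2 := by gcongr
    linarith
  have hW : ∀ n, W.mean (w n * w n) = ((H : ℝ)⁻¹ * (H : ℝ)⁻¹) * ∑ h ∈ Finset.range H,
      ∑ k ∈ Finset.range H, W.mean (u N (n + h) * u N (n + k)) := by
    intro n
    simp only [hw]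
    rw [smul_mul_smul_comm, Finset.sum_mul_sum, map_smul, smul_eq_mul]
    simp only [map_sum]
  have hB : W.mean (b * b) ≤ 4 * ε := by
    calc W.mean (b * b) ≤ (N : ℝ)⁻¹ * ∑ n ∈ Finset.range N, W.mean (w n * w n) :=
          W.mean_average_mul_self_le w hN
      _ = ((H : ℝ)⁻¹ * (H : ℝ)⁻¹) * ∑ h ∈ Finset.range H, ∑ k ∈ Finset.range H,
          (N : ℝ)⁻¹ * ∑ n ∈ Finset.range N, W.mean (u N (n + h) * u N (n + k)) := by
          simp only [hW, ← Finset.mul_sum]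
          rw [Finset.sum_comm, mul_left_comm]
          congr 3
          ext h
          rw [Finset.sum_comm]
      _ ≤ ((H : ℝ)⁻¹ * (H : ℝ)⁻¹) * ∑ h ∈ Finset.range H, ∑ k ∈ Finset.range H,
          (γ (Nat.dist h k) + 2 * ε) := by
          gcongr with h hh k hk
          rw [Finset.mem_range] at hh hk
          have e1 := W.average_correlation_le (hu N) N h k
          have e2 := h1 (Nat.dist h k) (by simp only [Nat.dist, Finset.mem_range]; omega)
          have e3 : (N : ℝ)⁻¹ * (2 * (h + k) * C ^ 2) ≤ (N : ℝ)⁻¹ * (2 * (H + H) * C ^ 2) := by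
            have : (h : ℝ) ≤ H := by exact_mod_cast hh.le
            have : (k : ℝ) ≤ H := by exact_mod_cast hk.le
            gcongr
          linarith
      _ = ((H : ℝ)⁻¹ * (H : ℝ)⁻¹) * ∑ h ∈ Finset.range H, ∑ k ∈ Finset.range H,
          γ (Nat.dist h k) + 2 * ε := by
          simp only [Finset.sum_add_distrib, Finset.sum_const, Finset.card_range, nsmul_eq_mul]
          field_simp
      _ ≤ ((H : ℝ)⁻¹ * (H : ℝ)⁻¹) * (2 * H * ∑ j ∈ Finset.range H, γ j) + 2 * ε := by
          gcongr
          exact sum_sum_dist_le hγ0 H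
      _ = 2 * ((H : ℝ)⁻¹ * ∑ j ∈ Finset.range H, γ j) + 2 * ε := by
          field_simp
      _ ≤ 4 * ε := by linarith
  linarith

end MixingSystem

/-! ### Polynomial sequences and their weight -/

/-- The sequence of polynomials `q` has degree `c.1` and leading coefficient `c.2`, the same at
every index; the lower coefficients are arbitrary. -/
def HasLead (q : ℕ → ℤ[X]) (c : ℕ × ℤ) : Prop :=
  c.2 ≠ 0 ∧ ∀ N, (q N).natDegree ≤ c.1 ∧ (q N).coeff c.1 = c.2

namespace HasLead

variable {q q' : ℕ → ℤ[X]} {c c' : ℕ × ℤ}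

theorem neg (hq : HasLead q c) : HasLead (-q) (c.1, -c.2) :=
  ⟨neg_ne_zero.2 hq.1, fun N => ⟨by simpa using (hq.2 N).1, by simpa using (hq.2 N).2⟩⟩

theorem taylor (hq : HasLead q c) (h : ℤ) : HasLead (fun N => Polynomial.taylor h (q N)) c := by
  have e : ∀ N, (q N).natDegree = c.1 := fun N => le_antisymm (hq.2 N).1 <|
    le_natDegree_of_ne_zero ((hq.2 N).2.symm ▸ hq.1)
  refine ⟨hq.1, fun N => ⟨by rw [natDegree_taylor]; exact (hq.2 N).1, ?_⟩⟩
  rw [← e N, coeff_taylor_natDegree, leadingCoeff, e N, (hq.2 N).2]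

theorem add_of_lt (hq : HasLead q c) (hq' : HasLead q' c') (h : c'.1 < c.1) :
    HasLead (q + q') c := by
  refine ⟨hq.1, fun N => ⟨?_, ?_⟩⟩
  · exact natDegree_add_le_of_degree_le (hq.2 N).1 ((hq'.2 N).1.trans h.le)
  · simp [coeff_eq_zero_of_natDegree_lt ((hq'.2 N).1.trans_lt h), (hq.2 N).2]

theorem add_of_eq {d : ℕ} {a b : ℤ} (hq : HasLead q (d, a)) (hq' : HasLead q' (d, b))
    (h : a + b ≠ 0) : HasLead (q + q') (d, a + b) := by
  refine ⟨h, fun N => ⟨?_, ?_⟩⟩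
  · exact natDegree_add_le_of_degree_le (hq.2 N).1 (hq'.2 N).1
  · simp [(hq.2 N).2, (hq'.2 N).2]

theorem taylor_sub_self {d : ℕ} {a : ℤ} (hq : HasLead q (d + 1, a)) {h : ℤ} (hh : h ≠ 0) :
    HasLead (fun N => Polynomial.taylor h (q N) - q N) (d, (d + 1) * a * h) := by
  refine ⟨mul_ne_zero (mul_ne_zero (by positivity) hq.1) hh, fun N => ⟨?_, ?_⟩⟩
  · rw [natDegree_le_iff_coeff_eq_zero]
    intro n hn
    rcases Nat.lt_or_ge (d + 1) n with h1 | h1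
    · rw [coeff_sub, coeff_eq_zero_of_natDegree_lt (((hq.taylor h).2 N).1.trans_lt h1),
        coeff_eq_zero_of_natDegree_lt ((hq.2 N).1.trans_lt h1), sub_zero]
    · obtain rfl : n = d + 1 := by omega
      rw [coeff_sub, ((hq.taylor h).2 N).2, (hq.2 N).2, sub_self]
  · have hlt : (hasseDeriv d (q N)).natDegree < 2 := by
      have h1 := natDegree_hasseDeriv_le (q N) d
      have h2 := (hq.2 N).1
      dsimp only at h2
      omega
    rw [coeff_sub, taylor_coeff, eval_eq_sum_range' hlt]
    have e := (hq.2 N).2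
    simp only [hasseDeriv_coeff, Finset.sum_range_succ, Finset.sum_range_zero]
    simp only [add_comm 1 d, e, zero_add, Nat.choose_self, Nat.choose_succ_self_right]
    push_cast
    ring

theorem eventually_taylor_sub_self_add (hq : HasLead q c) (hc : 2 ≤ c.1) (hq' : HasLead q' c')
    (hc' : 1 ≤ c'.1) : ∀ᶠ h : ℕ in atTop, ∃ e : ℕ × ℤ, 1 ≤ e.1 ∧
      HasLead (fun N => Polynomial.taylor (h : ℤ) (q N) - q N + q' N) e := by
  obtain ⟨d, a⟩ := c
  obtain ⟨d', b⟩ := c'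
  obtain ⟨d, rfl⟩ : ∃ k, d = k + 1 := ⟨d - 1, by dsimp only at hc; omega⟩
  dsimp only at hc hc'
  filter_upwards [eventually_gt_atTop b.natAbs] with h hh
  have hd := hq.taylor_sub_self (h := (h : ℤ)) (by omega)
  change ∃ e : ℕ × ℤ, 1 ≤ e.1 ∧ HasLead ((fun N => Polynomial.taylor (h : ℤ) (q N) - q N) + q') e
  rcases lt_trichotomy d d' with h1 | rfl | h1
  · exact ⟨(d', b), hc', add_comm q' _ ▸ hq'.add_of_lt hd h1⟩
  · refine ⟨(d, (d + 1) * a * h + b), hc', hd.add_of_eq hq' fun h0 => ?_⟩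
    -- Cancellation would force `|b| = (d + 1) |a| h ≥ h`, but `h > |b|`.
    have h2 : b.natAbs = (d + 1) * a.natAbs * h := by
      rw [← Int.natAbs_neg, ← eq_neg_of_add_eq_zero_left h0, Int.natAbs_mul, Int.natAbs_mul]
      norm_cast
    have h3 : 0 < a.natAbs := Int.natAbs_pos.2 hq.1
    have h4 : 1 ≤ (d + 1) * a.natAbs := Nat.mul_pos (by omega) h3
    have := Nat.mul_le_mul_right h h4
    omega
  · exact ⟨(d, (d + 1) * a * h), by omega, hd.add_of_lt hq' h1⟩

end HasLead

/-- The degree and leading coefficient of `q - q₀` when `q` and `q₀` have those given by `c` and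
`c₀`, provided `c ≠ c₀` and `q₀` has at most the degree of `q`. -/
def subClass (c₀ c : ℕ × ℤ) : ℕ × ℤ := if c.1 = c₀.1 then (c.1, c.2 - c₀.2) else c

theorem subClass_fst (c₀ c : ℕ × ℤ) : (subClass c₀ c).1 = c.1 := by
  unfold subClass; split_ifs <;> rfl

theorem subClass_injective (c₀ : ℕ × ℤ) : Function.Injective (subClass c₀) := by
  rintro ⟨d, a⟩ ⟨e, b⟩ h
  have h1 : d = e := by simpa [subClass_fst] using congrArg Prod.fst h
  subst h1
  have h2 := congrArg Prod.snd h
  simp only [subClass] at h2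
  split_ifs at h2 <;> simp_all

/-- Subtracting `q₀` from a polynomial sequence of at least its degree changes the degree and
leading coefficient in a controlled way, or, when both agree with those of `q₀`, lowers the
degree. -/
theorem HasLead.exists_sub {q q₀ : ℕ → ℤ[X]} {c c₀ e : ℕ × ℤ} (hq : HasLead q c)
    (hq₀ : HasLead q₀ c₀) (hc : c₀.1 ≤ c.1) (he : 1 ≤ e.1) (hc₀ : 1 ≤ c₀.1)
    (hs : HasLead (q - q₀) e) :
    ∃ c' : ℕ × ℤ, HasLead (q - q₀) c' ∧ 1 ≤ c'.1 ∧
      ((c ≠ c₀ ∧ c' = subClass c₀ c) ∨ c'.1 < c₀.1) := by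
  by_cases hcc : c = c₀
  · subst hcc
    refine ⟨e, hs, he, Or.inr ?_⟩
    by_contra! hlt
    have h1 := (hs.2 0).2
    rcases hlt.lt_or_eq with h2 | h2
    · rw [Pi.sub_apply, coeff_sub, coeff_eq_zero_of_natDegree_lt ((hq.2 0).1.trans_lt h2),
        coeff_eq_zero_of_natDegree_lt ((hq₀.2 0).1.trans_lt h2), sub_zero] at h1
      exact hs.1 h1.symm
    · rw [Pi.sub_apply, coeff_sub, ← h2, (hq.2 0).2, (hq₀.2 0).2, sub_self] at h1
      exact hs.1 h1.symm
  · refine ⟨subClass c₀ c, ?_, by rw [subClass_fst]; omega, Or.inl ⟨hcc, rfl⟩⟩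
    rw [sub_eq_add_neg]
    obtain ⟨d, a⟩ := c
    obtain ⟨d₀, a₀⟩ := c₀
    unfold subClass
    split_ifs with h1
    · dsimp only at h1
      subst h1
      have : a ≠ a₀ := fun h => hcc (by rw [h])
      exact hq.add_of_eq hq₀.neg (by dsimp only; omega)
    · exact hq.add_of_lt hq₀.neg (lt_of_le_of_ne hc (Ne.symm h1))

/-- A family of polynomial sequences whose members, and whose differences of distinct members, are
nonconstant with degree and leading coefficient independent of the index. The function `cls` records
the degrees and leading coefficients of the members; these may be negative. -/
structure IsAdmissible {ι : Type} (p : ι → ℕ → ℤ[X]) (cls : ι → ℕ × ℤ) : Prop where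
  hasLead : ∀ i, HasLead (p i) (cls i)
  one_le : ∀ i, 1 ≤ (cls i).1
  exists_sub : ∀ i j, i ≠ j → ∃ e : ℕ × ℤ, 1 ≤ e.1 ∧ HasLead (p i - p j) e

/-- The complexity of an admissible family on which the induction runs: the multiset of the
degrees of the distinct pairs (degree, leading coefficient) that occur in it. -/
def weight {ι : Type} [Fintype ι] (cls : ι → ℕ × ℤ) : Multiset ℕ :=
  (Finset.univ.image cls).val.map Prod.fst

/-- Removing a member of minimal degree `d` and subtracting it from the others lowers the weight:
its class, one entry `d`, is replaced by classes of degree less than `d`, while the remaining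
classes are translated injectively without changing their degrees. -/
theorem IsAdmissible.exists_sub_weight_lt {ι : Type} [Fintype ι] [DecidableEq ι]
    {p : ι → ℕ → ℤ[X]}
    {cls : ι → ℕ × ℤ} (hp : IsAdmissible p cls) {i₀ : ι} (hi₀ : ∀ i, (cls i₀).1 ≤ (cls i).1) :
    ∃ cls' : {i // i ≠ i₀} → ℕ × ℤ, IsAdmissible (fun i : {i // i ≠ i₀} => p i - p i₀) cls' ∧
      Multiset.IsDershowitzMannaLT (weight cls') (weight cls) := by
  have h : ∀ i : {i // i ≠ i₀}, ∃ c' : ℕ × ℤ, HasLead (p i - p i₀) c' ∧ 1 ≤ c'.1 ∧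
      ((cls i ≠ cls i₀ ∧ c' = subClass (cls i₀) (cls i)) ∨ c'.1 < (cls i₀).1) := by
    intro i
    obtain ⟨e, he, hs⟩ := hp.exists_sub i i₀ i.2
    exact (hp.hasLead i).exists_sub (hp.hasLead i₀) (hi₀ i) he (hp.one_le i₀) hs
  choose cls' h1 h2 h3 using h
  refine ⟨cls', ⟨h1, h2, fun i j hij => ?_⟩, ?_⟩
  · obtain ⟨e, he, hs⟩ := hp.exists_sub i j (fun h => hij (Subtype.ext h))
    exact ⟨e, he, by simpa using hs⟩
  set S := Finset.univ.image cls with hS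
  set S' := Finset.univ.image cls' with hS'
  have hmem : cls i₀ ∈ S := Finset.mem_image_of_mem _ (Finset.mem_univ _)
  set d := (cls i₀).1
  have hsub : S'.filter (fun c => ¬ c.1 < d) ⊆ (S.erase (cls i₀)).image (subClass (cls i₀)) := by
    intro c hc
    obtain ⟨hc1, hc2⟩ := Finset.mem_filter.1 hc
    obtain ⟨i, -, rfl⟩ := Finset.mem_image.1 hc1
    rcases h3 i with ⟨h4, h5⟩ | h4
    · exact Finset.mem_image.2 ⟨cls i, Finset.mem_erase.2
        ⟨h4, Finset.mem_image_of_mem _ (Finset.mem_univ _)⟩, h5.symm⟩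
    · exact absurd h4 hc2
  have hle : (S'.filter (fun c => ¬ c.1 < d)).val.map Prod.fst ≤
      (S.erase (cls i₀)).val.map Prod.fst := by
    refine (Multiset.map_le_map (Finset.val_le_iff.2 hsub)).trans_eq ?_
    rw [Finset.image_val_of_injOn (subClass_injective _).injOn, Multiset.map_map]
    exact Multiset.map_congr rfl fun c _ => subClass_fst _ _
  obtain ⟨E, hE⟩ := Multiset.le_iff_exists_add.1 hle
  refine ⟨(S'.filter (fun c => ¬ c.1 < d)).val.map Prod.fst,
    (S'.filter (fun c => c.1 < d)).val.map Prod.fst, E + {d}, by simp, ?_, ?_, ?_⟩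
  · rw [weight, ← hS', ← Multiset.map_add, add_comm, Finset.filter_val, Finset.filter_val,
      Multiset.filter_add_not]
  · rw [weight, ← hS, ← add_assoc, ← hE, ← Finset.insert_erase hmem,
      Finset.insert_val_of_notMem (Finset.notMem_erase _ _), Finset.erase_insert
      (Finset.notMem_erase _ _), Multiset.map_cons, add_comm, Multiset.singleton_add]
  · intro y hy
    refine ⟨d, by simp, ?_⟩
    obtain ⟨c, hc, rfl⟩ := Multiset.mem_map.1 hy
    exact (Finset.mem_filter.1 hc).2

section Extend

variable {ι : Type} (p : ι → ℕ → ℤ[X]) (cls : ι → ℕ × ℤ)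

/-- The family `p` together with the polynomials `p j (X + h)` for those `j` of degree at least two.
For a linear member, `p j (X + h)` differs from `p j` by a constant, so adjoining it would destroy
admissibility. -/
noncomputable def withShifts (h : ℕ) : ι ⊕ {i // 2 ≤ (cls i).1} → ℕ → ℤ[X] :=
  Sum.elim p fun j N => taylor (h : ℤ) (p j N)

/-- The degrees and leading coefficients in the family `withShifts`. -/
def withShiftsClass : ι ⊕ {i // 2 ≤ (cls i).1} → ℕ × ℤ := Sum.elim cls fun j => cls j

theorem weight_withShiftsClass [Fintype ι] : weight (withShiftsClass cls) = weight cls := by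
  unfold weight
  congr 2
  ext c
  simp [withShiftsClass]
  tauto

variable {p cls}

/-- For a pair `p i (X + h)`, `p j` the leading terms may cancel, but only for finitely many `h`. -/
theorem IsAdmissible.eventually_withShifts [Finite ι] (hp : IsAdmissible p cls) :
    ∀ᶠ h : ℕ in atTop, IsAdmissible (withShifts p cls h) (withShiftsClass cls) := by
  have key : ∀ᶠ h : ℕ in atTop, ∀ (i : {i // 2 ≤ (cls i).1}) (j : ι),
      ∃ e : ℕ × ℤ, 1 ≤ e.1 ∧
        HasLead (withShifts p cls h (Sum.inr i) - withShifts p cls h (Sum.inl j)) e := by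
    refine eventually_all.2 fun i => eventually_all.2 fun j => ?_
    by_cases hij : (i : ι) = j
    · filter_upwards [eventually_gt_atTop 0] with h hh
      obtain ⟨d, hd⟩ : ∃ d, (cls i).1 = d + 1 := ⟨(cls i).1 - 1, by have := i.2; omega⟩
      have h1 : HasLead (p i) (d + 1, (cls i).2) := hd ▸ hp.hasLead i
      refine ⟨(d, (d + 1) * (cls i).2 * h), ?_,
        hij ▸ h1.taylor_sub_self (h := (h : ℤ)) (by omega)⟩
      have := i.2
      dsimp only
      omega
    · obtain ⟨e, he, hs⟩ := hp.exists_sub i j hij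
      filter_upwards [(hp.hasLead i).eventually_taylor_sub_self_add i.2 hs he] with h hh
      obtain ⟨e', he', hs'⟩ := hh
      refine ⟨e', he', ?_⟩
      convert hs' using 1
      ext1 N
      simp [withShifts]
  filter_upwards [key] with h hh
  refine ⟨?_, ?_, ?_⟩
  · rintro (i | i)
    · exact hp.hasLead i
    · exact (hp.hasLead i).taylor h
  · rintro (i | i) <;> exact hp.one_le i
  · rintro (i | i) (j | j) hij
    · exact hp.exists_sub i j fun h => hij (congrArg _ h)
    · obtain ⟨e, he, hs⟩ := hh j i
      exact ⟨(e.1, -e.2), he, by simpa using hs.neg⟩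
    · exact hh i j
    · obtain ⟨e, he, hs⟩ := hp.exists_sub i j fun h => hij (congrArg _ (Subtype.ext h))
      refine ⟨e, he, ?_⟩
      convert hs.taylor h using 1
      ext1 N
      simp [withShifts]

end Extend

/-! ### The polynomial ergodic theorem -/

theorem HasLead.eval_add_of_linear {q : ℕ → ℤ[X]} {a : ℤ} (hq : HasLead q (1, a)) (N : ℕ)
    (x y : ℤ) : (q N).eval (x + y) = (q N).eval x + a * y := by
  have h : (q N).natDegree < 2 := Nat.lt_succ_of_le (hq.2 N).1
  have e := (hq.2 N).2
  dsimp only at e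
  rw [eval_eq_sum_range' h, eval_eq_sum_range' h]
  simp only [Finset.sum_range_succ, Finset.sum_range_zero, e]
  ring

theorem tendsto_cesaro_of_eventually_le {γ δ : ℕ → ℝ} {K : ℝ} (hγ : ∀ h, 0 ≤ γ h)
    (hle : ∀ᶠ h in atTop, γ h ≤ K * δ h)
    (hδ : Tendsto (fun H : ℕ => (H : ℝ)⁻¹ * ∑ h ∈ Finset.range H, δ h) atTop (𝓝 0)) :
    Tendsto (fun H : ℕ => (H : ℝ)⁻¹ * ∑ h ∈ Finset.range H, γ h) atTop (𝓝 0) := by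
  have h1 : Tendsto (fun h => max (γ h - K * δ h) 0) atTop (𝓝 0) :=
    tendsto_const_nhds.congr' (hle.mono fun h hh => (max_eq_right (by linarith)).symm)
  have h2 := h1.cesaro.add (hδ.const_mul K)
  rw [mul_zero, add_zero] at h2
  refine squeeze_zero (fun H => mul_nonneg (by positivity) (Finset.sum_nonneg fun h _ => hγ h))
    (fun H => ?_) h2
  rw [mul_left_comm, ← mul_add]
  refine mul_le_mul_of_nonneg_left ?_ (by positivity)
  rw [Finset.mul_sum, ← Finset.sum_add_distrib]
  refine Finset.sum_le_sum fun h _ => ?_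
  linarith [le_max_left (γ h - K * δ h) 0]

namespace MixingSystem

variable {R : Type*} [NormedCommRing R] [NormedAlgebra ℝ R] (W : MixingSystem R)

theorem mean_algebraMap (c : ℝ) : W.mean (algebraMap ℝ R c) = c := by
  rw [Algebra.algebraMap_eq_smul_one, map_smul, W.mean_one, smul_eq_mul, mul_one]

theorem mean_mul_shift_neg (f : R) (k : ℤ) :
    W.mean (f * W.shift (-k) f) = W.mean (f * W.shift k f) := by
  rw [← W.mean_shift k, map_mul, ← W.shift_add, add_neg_cancel, W.shift_zero, mul_comm]

/-- Weak mixing along the multiples of `a`: these make up a positive proportion of all lags. -/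
theorem tendsto_correlation_mul {f : R} (hf : W.mean f = 0) {a : ℤ} (ha : a ≠ 0) :
    Tendsto (fun H : ℕ => (H : ℝ)⁻¹ * ∑ h ∈ Finset.range H, |W.mean (f * W.shift (a * h) f)|)
      atTop (𝓝 0) := by
  have ha' : 0 < a.natAbs := Int.natAbs_pos.2 ha
  have e : ∀ h : ℕ, W.mean (f * W.shift (a * h) f) =
      W.mean (f * W.shift ((a.natAbs * h : ℕ) : ℤ) f) := by
    intro h
    rcases Int.natAbs_eq a with h1 | h1
    · rw [Nat.cast_mul, ← h1]
    · rw [← W.mean_mul_shift_neg, Nat.cast_mul, ← neg_mul,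
        show (a.natAbs : ℤ) = -a by omega]
  simp only [e]
  have h1 := ((W.tendsto_correlation f hf).comp
    (tendsto_id.const_mul_atTop' ha')).const_mul (a.natAbs : ℝ)
  rw [mul_zero] at h1
  refine squeeze_zero (fun H => by positivity) (fun H => ?_) h1
  simp only [Function.comp_apply, id]
  rw [Nat.cast_mul (α := ℝ), mul_inv]
  have ha'' : (a.natAbs : ℝ) ≠ 0 := by positivity
  rw [mul_assoc, mul_inv_cancel_left₀ ha'']
  gcongr
  rw [← Finset.sum_image (f := fun k : ℕ => |W.mean (f * W.shift (k : ℤ) f)|)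
    (g := fun h => a.natAbs * h) (fun x _ y _ hxy => Nat.eq_of_mul_eq_mul_left ha' hxy)]
  refine Finset.sum_le_sum_of_subset_of_nonneg ?_ fun _ _ _ => abs_nonneg _
  intro k hk
  obtain ⟨h, hh, rfl⟩ := Finset.mem_image.1 hk
  exact Finset.mem_range.2 (Nat.mul_lt_mul_of_pos_left (Finset.mem_range.1 hh) ha')

/-- The sequence `X` tends to zero in mean square. -/
def IsNull (X : ℕ → R) : Prop := Tendsto (fun N => W.mean (X N * X N)) atTop (𝓝 0)

variable {W} in
theorem IsNull.add {X Y : ℕ → R} (hX : W.IsNull X) (hY : W.IsNull Y) :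
    W.IsNull fun N => X N + Y N := by
  have h := (hX.const_mul 2).add (hY.const_mul 2)
  simp only [mul_zero, add_zero] at h
  exact squeeze_zero (fun N => W.mean_mul_self_nonneg _)
    (fun N => W.mean_add_mul_self_le _ _) h

variable {W} in
theorem IsNull.tendsto_mean_mul {X : ℕ → R} (hX : W.IsNull X) (f : R) :
    Tendsto (fun N => W.mean (f * X N)) atTop (𝓝 0) := by
  have h1 := Tendsto.const_mul (W.mean (f * f)) hX
  rw [mul_zero] at h1
  have h2 : Tendsto (fun N => W.mean (f * X N) ^ 2) atTop (𝓝 0) :=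
    squeeze_zero (fun N => sq_nonneg _) (fun N => W.mean_mul_sq_le f (X N)) h1
  have h3 := h2.sqrt
  simp only [Real.sqrt_sq_eq_abs, Real.sqrt_zero] at h3
  exact (tendsto_zero_iff_abs_tendsto_zero _).2 h3

section

variable {ι : Type} [Fintype ι]

/-- The product of the observables `f i`, shifted by the values of `p i N` at `n + 1`. The argument
`n + 1` makes `n ∈ Finset.range N` correspond to the integers from `1` to `N`. -/
noncomputable def prodShift (p : ι → ℕ → ℤ[X]) (f : ι → R) (N n : ℕ) : R :=
  ∏ i, W.shift ((p i N).eval ((n : ℤ) + 1)) (f i)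

/-- The difference between the average of `prodShift` over `n < N` and the product of the means. -/
noncomputable def deviation (p : ι → ℕ → ℤ[X]) (f : ι → R) (N : ℕ) : R :=
  (N : ℝ)⁻¹ • ∑ n ∈ Finset.range N, W.prodShift p f N n - algebraMap ℝ R (∏ i, W.mean (f i))

theorem norm_prodShift_le [Nonempty ι] (p : ι → ℕ → ℤ[X]) (f : ι → R) (N n : ℕ) :
    ‖W.prodShift p f N n‖ ≤ ∏ i, ‖f i‖ :=
  (Finset.norm_prod_le' _ Finset.univ_nonempty _).trans <|
    Finset.prod_le_prod (fun _ _ => norm_nonneg _) fun _ _ => W.norm_shift_le _ _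

/-- The observables belonging to `withShifts p cls h`: for a linear member of the family, the
observable and its copy shifted by the constant `p i (X + h) - p i` are merged into one product. -/
def mergeFun (cls : ι → ℕ × ℤ) (f : ι → R) (h : ℕ) : ι ⊕ {i // 2 ≤ (cls i).1} → R :=
  Sum.elim (fun i => if 2 ≤ (cls i).1 then f i else f i * W.shift ((cls i).2 * h) (f i))
    fun j => f j

theorem prodShift_mul_prodShift {p : ι → ℕ → ℤ[X]} {cls : ι → ℕ × ℤ} (hp : IsAdmissible p cls)
    (f : ι → R) (N n h : ℕ) :
    W.prodShift p f N n * W.prodShift p f N (n + h) =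
      W.prodShift (withShifts p cls h) (W.mergeFun cls f h) N n := by
  have e : ∏ j : {i // 2 ≤ (cls i).1}, W.shift ((p j N).eval ((n : ℤ) + 1 + h)) (f j) =
      ∏ i, if 2 ≤ (cls i).1 then W.shift ((p i N).eval ((n : ℤ) + 1 + h)) (f i) else 1 := by
    rw [← Finset.prod_filter]
    exact (Finset.prod_subtype _ (by simp) fun i =>
      W.shift ((p i N).eval ((n : ℤ) + 1 + h)) (f i)).symm
  simp only [prodShift, Fintype.prod_sum_type, withShifts, mergeFun, Sum.elim_inl, Sum.elim_inr,
    taylor_eval, e, ← Finset.prod_mul_distrib]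
  refine Finset.prod_congr rfl fun i _ => ?_
  have e1 : ((n + h : ℕ) : ℤ) + 1 = n + 1 + h := by push_cast; ring
  rw [e1]
  split_ifs with hi
  · rfl
  · have h1 : HasLead (p i) (1, (cls i).2) := by
      have : (cls i).1 = 1 := by have := hp.one_le i; omega
      rw [← this]
      exact hp.hasLead i
    rw [h1.eval_add_of_linear N (n + 1) h, W.shift_add, map_mul, mul_one]

variable [DecidableEq ι]

variable {W} in
/-- By shift invariance the mean of a product depends only on the differences of the shifts, so `p
i₀` may be subtracted from all members; the factor at `i₀` then no longer depends on `n`. -/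
theorem tendsto_mean_prodShift {p : ι → ℕ → ℤ[X]} {f : ι → R} {i₀ : ι}
    (h : W.IsNull (W.deviation (fun i : {i // i ≠ i₀} => p i - p i₀) fun i => f i)) :
    Tendsto (fun N : ℕ => (N : ℝ)⁻¹ * ∑ n ∈ Finset.range N, W.mean (W.prodShift p f N n)) atTop
      (𝓝 (∏ i, W.mean (f i))) := by
  have h1 := (h.tendsto_mean_mul (f i₀)).add_const (∏ i, W.mean (f i))
  rw [zero_add] at h1
  refine h1.congr fun N => ?_
  have e : ∀ n, W.mean (W.prodShift p f N n) =
      W.mean (f i₀ * W.prodShift (fun i : {i // i ≠ i₀} => p i - p i₀) (fun i => f i) N n) := by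
    intro n
    rw [← W.mean_shift (-(p i₀ N).eval ((n : ℤ) + 1)), prodShift, map_prod,
      Fintype.prod_eq_mul_prod_subtype_ne _ i₀]
    simp only [← W.shift_add, neg_add_cancel, W.shift_zero, prodShift, Pi.sub_apply, eval_sub,
      neg_add_eq_sub]
  simp only [e]
  rw [← map_sum, ← Finset.mul_sum, Fintype.prod_eq_mul_prod_subtype_ne _ i₀, deviation, mul_sub,
    map_sub, mul_smul_comm, map_smul, smul_eq_mul, mul_comm (f i₀) (algebraMap ℝ R _),
    ← Algebra.smul_def, map_smul, smul_eq_mul]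
  ring

/-- The limiting correlations at lag `h` vanish, or are controlled by the autocorrelation of an
observable of mean zero, according as its polynomial is nonlinear or linear. -/
theorem exists_prod_mean_mergeFun_le (cls : ι → ℕ × ℤ) {f : ι → R} {j : ι} (hj : W.mean (f j) = 0) :
    ∃ K : ℝ, ∀ h : ℕ, |∏ x, W.mean (W.mergeFun cls f h x)| ≤
      K * if 2 ≤ (cls j).1 then 0 else |W.mean (f j * W.shift ((cls j).2 * h) (f j))| := by
  refine ⟨(∏ i : {i // i ≠ j}, (‖f i‖ + ‖f i‖ * ‖f i‖)) *
    ∏ i : {i // 2 ≤ (cls i).1}, |W.mean (f i)|, fun h => ?_⟩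
  rw [Fintype.prod_sum_type, Fintype.prod_eq_mul_prod_subtype_ne _ j, abs_mul, abs_mul,
    Finset.abs_prod, Finset.abs_prod]
  have e : |W.mean (W.mergeFun cls f h (Sum.inl j))| =
      if 2 ≤ (cls j).1 then 0 else |W.mean (f j * W.shift ((cls j).2 * h) (f j))| := by
    simp only [mergeFun, Sum.elim_inl]
    split_ifs <;> simp [hj]
  have hb : ∏ i : {i // i ≠ j}, |W.mean (W.mergeFun cls f h (Sum.inl i))| ≤
      ∏ i : {i // i ≠ j}, (‖f i‖ + ‖f i‖ * ‖f i‖) := by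
    refine Finset.prod_le_prod (fun _ _ => abs_nonneg _) fun i _ => (W.abs_mean_le _).trans ?_
    simp only [mergeFun, Sum.elim_inl]
    split_ifs
    · exact le_add_of_nonneg_right (by positivity)
    · refine (norm_mul_le _ _).trans ?_
      have := mul_le_mul_of_nonneg_left (W.norm_shift_le ((cls i).2 * h) (f i)) (norm_nonneg (f i))
      linarith [norm_nonneg (f i)]
  rw [e, mul_comm, mul_comm (ite _ _ _), ← mul_assoc, mul_comm (∏ i : {i // i ≠ j}, _)]
  simp only [mergeFun, Sum.elim_inr]
  have h0 : (0 : ℝ) ≤ if 2 ≤ (cls j).1 then 0 else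
      |W.mean (f j * W.shift ((cls j).2 * h) (f j))| := by split_ifs <;> positivity
  have h1 : 0 ≤ ∏ i : {i // 2 ≤ (cls i).1}, |W.mean (f i)| :=
    Finset.prod_nonneg fun _ _ => abs_nonneg _
  exact mul_le_mul_of_nonneg_right (mul_le_mul_of_nonneg_left hb h1) h0

variable {W} in
/-- The inductive step: when one observable has mean zero, van der Corput's lemma reduces the
claim to families of smaller weight. -/
theorem isNull_deviation_of_mean_eq_zero {p : ι → ℕ → ℤ[X]} {cls : ι → ℕ × ℤ}
    (hp : IsAdmissible p cls)
    (ih : ∀ (κ : Type) [Fintype κ] (q : κ → ℕ → ℤ[X]) (cls' : κ → ℕ × ℤ), IsAdmissible q cls' →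
      Multiset.IsDershowitzMannaLT (weight cls') (weight cls) →
      ∀ g : κ → R, W.IsNull (W.deviation q g))
    {f : ι → R} {j : ι} (hj : W.mean (f j) = 0) : W.IsNull (W.deviation p f) := by
  classical
  have : Nonempty ι := ⟨j⟩
  obtain ⟨i₀, hi₀⟩ := Finite.exists_min fun i => (cls i).1
  have hlim : ∀ᶠ h : ℕ in atTop, Tendsto (fun N : ℕ => (N : ℝ)⁻¹ * ∑ n ∈ Finset.range N,
      W.mean (W.prodShift p f N n * W.prodShift p f N (n + h))) atTop
      (𝓝 (∏ x, W.mean (W.mergeFun cls f h x))) := by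
    filter_upwards [hp.eventually_withShifts] with h hh
    simp only [W.prodShift_mul_prodShift hp]
    obtain ⟨cls', hc1, hc2⟩ := hh.exists_sub_weight_lt (i₀ := Sum.inl i₀) (by
      rintro (i | i) <;> exact hi₀ i)
    rw [weight_withShiftsClass] at hc2
    exact tendsto_mean_prodShift (ih _ _ _ hc1 hc2 _)
  obtain ⟨h₀, hh₀⟩ := eventually_atTop.1 hlim
  obtain ⟨K, hK⟩ := W.exists_prod_mean_mergeFun_le cls hj
  set C := ∏ i, ‖f i‖ with hC
  have hC0 : 0 ≤ C := Finset.prod_nonneg fun _ _ => norm_nonneg _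
  -- The finitely many lags `h < h₀` get the trivial bound.
  set γ : ℕ → ℝ := fun h => if h₀ ≤ h then |∏ x, W.mean (W.mergeFun cls f h x)| else C * C with hγ
  have hγ0 : ∀ h, 0 ≤ γ h := fun h => by simp only [hγ]; split_ifs <;> positivity
  have e0 : W.deviation p f = fun N : ℕ =>
      (N : ℝ)⁻¹ • ∑ n ∈ Finset.range N, W.prodShift p f N n := by
    ext1 N
    rw [deviation, Finset.prod_eq_zero (Finset.mem_univ j) hj, map_zero, sub_zero]
  rw [e0]
  refine W.van_der_corput (γ := γ) (W.norm_prodShift_le p f) hγ0 ?_ ?_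
  · intro h ε hε
    simp only [hγ]
    split_ifs with hh
    · refine ((hh₀ h hh).eventually_lt_const (u := |_| + ε) ?_).mono fun N hN => hN.le
      exact lt_of_le_of_lt (le_abs_self _) (lt_add_of_pos_right _ hε)
    · filter_upwards [eventually_gt_atTop 0] with N hN
      have hN' : (0 : ℝ) < N := by exact_mod_cast hN
      refine le_trans ?_ (le_add_of_nonneg_right hε.le)
      have hle : ∀ n ∈ Finset.range N,
          W.mean (W.prodShift p f N n * W.prodShift p f N (n + h)) ≤ C * C := fun n _ =>
        (le_abs_self _).trans <| (W.abs_mean_le _).trans <| (norm_mul_le _ _).trans <|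
          mul_le_mul (W.norm_prodShift_le p f N n) (W.norm_prodShift_le p f N _)
            (norm_nonneg _) hC0
      rw [inv_mul_le_iff₀ hN']
      simpa using Finset.sum_le_card_nsmul _ _ _ hle
  · refine tendsto_cesaro_of_eventually_le (K := K) hγ0 (eventually_atTop.2 ⟨h₀, fun h hh => ?_⟩)
      (δ := fun h => if 2 ≤ (cls j).1 then 0 else
        |W.mean (f j * W.shift ((cls j).2 * h) (f j))|) ?_
    · simp only [hγ, if_pos hh]
      exact hK h
    · split_ifs
      · simp
      · exact W.tendsto_correlation_mul hj (hp.hasLead j).1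

theorem deviation_update_add (p : ι → ℕ → ℤ[X]) (f : ι → R) (a : ι) (x y : R) (N : ℕ) :
    W.deviation p (Function.update f a (x + y)) N =
      W.deviation p (Function.update f a x) N + W.deviation p (Function.update f a y) N := by
  have e1 : ∀ z n, W.prodShift p (Function.update f a z) N n =
      W.shift ((p a N).eval ((n : ℤ) + 1)) z *
        W.prodShift (fun i : {i // i ≠ a} => p i) (fun i => f i) N n := by
    intro z n
    rw [prodShift, Fintype.prod_eq_mul_prod_subtype_ne _ a, Function.update_self, prodShift]
    congr 1
    exact Finset.prod_congr rfl fun i _ => by rw [Function.update_of_ne i.2]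
  have e2 : ∀ z, ∏ i, W.mean (Function.update f a z i) =
      W.mean z * ∏ i : {i // i ≠ a}, W.mean (f i) := by
    intro z
    rw [Fintype.prod_eq_mul_prod_subtype_ne _ a, Function.update_self]
    congr 1
    exact Finset.prod_congr rfl fun i _ => by rw [Function.update_of_ne i.2]
  simp only [deviation, e1, e2, map_add, add_mul, Finset.sum_add_distrib, smul_add]
  abel

end

/-- **Polynomial ergodic theorem for weakly mixing systems**, uniform in the polynomials: the
averages of an admissible family converge in mean square to the product of the means, even when
the lower coefficients vary arbitrarily with `N`. -/
theorem isNull_deviation {ι : Type} [Fintype ι] {p : ι → ℕ → ℤ[X]} {cls : ι → ℕ × ℤ}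
    (hp : IsAdmissible p cls) (f : ι → R) : W.IsNull (W.deviation p f) := by
  classical
  obtain ⟨M, hw⟩ : ∃ M, weight cls = M := ⟨_, rfl⟩
  induction M using (Multiset.wellFounded_isDershowitzMannaLT (α := ℕ)).induction
    generalizing ι with
  | _ M ih =>
  subst hw
  have ih' : ∀ (κ : Type) [Fintype κ] (q : κ → ℕ → ℤ[X]) (cls' : κ → ℕ × ℤ), IsAdmissible q cls' →
      Multiset.IsDershowitzMannaLT (weight cls') (weight cls) →
      ∀ g : κ → R, W.IsNull (W.deviation q g) := fun κ _ q cls' hq hlt g => ih _ hlt hq g rfl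
  -- By multilinearity, observables are replaced by their means one at a time; `t` is the set of
  -- indices at which the observable may still be nonconstant.
  suffices key : ∀ (t : Finset ι) (f : ι → R), (∀ i ∉ t, f i = algebraMap ℝ R (W.mean (f i))) →
      W.IsNull (W.deviation p f) from key Finset.univ f (by simp)
  intro t
  induction t using Finset.induction_on with
  | empty =>
    intro f hf
    have e : ∀ᶠ N in atTop, W.deviation p f N = 0 := by
      filter_upwards [eventually_gt_atTop 0] with N hN
      have hN' : (N : ℝ) ≠ 0 := by exact_mod_cast hN.ne'
      have e1 : ∀ n, W.prodShift p f N n = algebraMap ℝ R (∏ i, W.mean (f i)) := by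
        intro n
        rw [map_prod]
        refine Finset.prod_congr rfl fun i _ => ?_
        rw [hf i (by simp), AlgHom.commutes, W.mean_algebraMap]
      simp only [deviation, e1, Finset.sum_const, Finset.card_range]
      rw [← Nat.cast_smul_eq_nsmul ℝ, smul_smul, inv_mul_cancel₀ hN', one_smul, sub_self]
    refine tendsto_const_nhds.congr' (e.mono fun N hN => ?_)
    simp only [hN, mul_zero, map_zero]
  | insert a t _ iht =>
    intro f hf
    have e : W.deviation p f = fun N =>
        W.deviation p (Function.update f a (f a - algebraMap ℝ R (W.mean (f a)))) N +
        W.deviation p (Function.update f a (algebraMap ℝ R (W.mean (f a)))) N := by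
      ext1 N
      rw [← deviation_update_add, sub_add_cancel, Function.update_eq_self]
    rw [e]
    refine IsNull.add (isNull_deviation_of_mean_eq_zero hp ih' (j := a) ?_) (iht _ fun i hi => ?_)
    · rw [Function.update_self, map_sub, W.mean_algebraMap, sub_self]
    · by_cases hia : i = a
      · subst hia
        rw [Function.update_self, W.mean_algebraMap]
      · rw [Function.update_of_ne hia]
        exact hf i (by simp [hia, hi])

end MixingSystem

/-! ### The system of observables along a generic orbit -/

theorem sum_Icc_one_eq_sum_range {M : Type*} [AddCommMonoid M] (v : ℕ → M) (N : ℕ) :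
    ∑ n ∈ Finset.Icc 1 N, v n = ∑ n ∈ Finset.range N, v (n + 1) := by
  induction N with
  | zero => simp
  | succ N ih => rw [Finset.sum_Icc_succ_top (by omega), ih, Finset.sum_range_succ]

open scoped BoundedContinuousFunction

/-- The average of `F` over the integers from `1` to `N`. -/
noncomputable def orbitAverage (F : ℤ →ᵇ ℝ) (N : ℕ) : ℝ :=
  (N : ℝ)⁻¹ * ∑ n ∈ Finset.range N, F ((n : ℤ) + 1)

/-- The translate `m ↦ F (m + k)`. -/
def shiftBy (k : ℤ) (F : ℤ →ᵇ ℝ) : ℤ →ᵇ ℝ :=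
  F.compContinuous ⟨fun m => m + k, continuous_of_discreteTopology⟩

theorem shiftBy_apply (k : ℤ) (F : ℤ →ᵇ ℝ) (m : ℤ) : shiftBy k F m = F (m + k) := rfl

theorem tendsto_orbitAverage_translate {F : ℤ →ᵇ ℝ} {L : ℝ}
    (hF : Tendsto (orbitAverage F) atTop (𝓝 L)) (k : ℤ) :
    Tendsto (orbitAverage (shiftBy k F)) atTop (𝓝 L) := by
  have key : ∀ (G : ℤ →ᵇ ℝ) (h : ℕ),
      Tendsto (fun N => orbitAverage (shiftBy h G) N - orbitAverage G N) atTop (𝓝 0) := by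
    intro G h
    have hlim : Tendsto (fun N : ℕ => (N : ℝ)⁻¹ * (2 * h * ‖G‖)) atTop (𝓝 0) := by
      simpa using (tendsto_inv_atTop_nhds_zero_nat (𝕜 := ℝ)).mul_const (2 * h * ‖G‖)
    refine squeeze_zero_norm (fun N => ?_) hlim
    rw [orbitAverage, orbitAverage, ← mul_sub, norm_mul, norm_inv, RCLike.norm_natCast]
    refine mul_le_mul_of_nonneg_left ?_ (by positivity)
    have := norm_sum_range_add_sub_le (v := fun n : ℕ => G ((n : ℤ) + 1)) (C := ‖G‖)
      (fun n => G.norm_coe_le_norm _) N h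
    simpa only [shiftBy_apply, Nat.cast_add, add_right_comm] using this
  rcases Int.eq_nat_or_neg k with ⟨h, rfl | rfl⟩
  · simpa using (key F h).add hF
  · have := hF.sub (key (shiftBy (-h) F) h)
    have e : shiftBy h (shiftBy (-h) F) = F := by ext m; simp [shiftBy_apply]
    simpa [e] using this

/-- Weak mixing for a simple function, by expanding it over its level sets. -/
theorem IsWeaklyMixing.tendsto_correlation {X : Type*} [MeasurableSpace X] {T : X → X}
    {μ : Measure X} [IsProbabilityMeasure μ] (hmix : IsWeaklyMixing T μ) (hT : Measurable T)
    {φ : X → ℝ} (hφ : Measurable φ) (hfin : (Set.range φ).Finite) :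
    Tendsto (fun N : ℕ => (∑ n ∈ Finset.Icc 1 N,
      |∫ x, φ x * φ (T^[n] x) ∂μ - (∫ x, φ x ∂μ) * ∫ x, φ x ∂μ|) / (N : ℝ)) atTop (𝓝 0) := by
  set s := hfin.toFinset with hs
  set E : ℝ → Set X := fun c => φ ⁻¹' {c} with hE
  have hEm : ∀ c, MeasurableSet (E c) := fun c => hφ (measurableSet_singleton c)
  have hdec : ∀ x, φ x = ∑ c ∈ s, c * (E c).indicator 1 x := by
    intro x
    rw [Finset.sum_eq_single (φ x)]
    · simp [hE]
    · intro c _ hc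
      simp [hE, hc.symm]
    · intro h
      exact absurd (hfin.mem_toFinset.2 ⟨x, rfl⟩) h
  have hint : ∫ x, φ x ∂μ = ∑ c ∈ s, c * μ.real (E c) := by
    simp_rw [hdec]
    have hi : ∀ c, Integrable (fun x => c * (E c).indicator (1 : X → ℝ) x) μ := fun c =>
      ((integrable_const (1 : ℝ)).indicator (hEm c)).const_mul c
    rw [integral_finsetSum _ fun c _ => hi c]
    refine Finset.sum_congr rfl fun c _ => ?_
    rw [integral_const_mul, integral_indicator_one (hEm c)]
  have hcor : ∀ n, ∫ x, φ x * φ (T^[n] x) ∂μ =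
      ∑ c ∈ s, ∑ c' ∈ s, c * c' * μ.real (E c ∩ T^[n] ⁻¹' E c') := by
    intro n
    have hm : ∀ c c', MeasurableSet (E c ∩ T^[n] ⁻¹' E c') := fun c c' =>
      (hEm c).inter (hT.iterate n (hEm c'))
    have e : ∀ x, φ x * φ (T^[n] x) =
        ∑ c ∈ s, ∑ c' ∈ s, c * c' * (E c ∩ T^[n] ⁻¹' E c').indicator (1 : X → ℝ) x := by
      intro x
      rw [hdec x, hdec (T^[n] x), Finset.sum_mul_sum]
      refine Finset.sum_congr rfl fun c _ => Finset.sum_congr rfl fun c' _ => ?_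
      rw [mul_mul_mul_comm, Set.inter_indicator_one]
      rfl
    have hi : ∀ c c', Integrable
        (fun x => c * c' * (E c ∩ T^[n] ⁻¹' E c').indicator (1 : X → ℝ) x) μ := fun c c' =>
      ((integrable_const (1 : ℝ)).indicator (hm c c')).const_mul _
    simp_rw [e]
    rw [integral_finsetSum _ fun c _ => integrable_finsetSum _ fun c' _ => hi c c']
    refine Finset.sum_congr rfl fun c _ => ?_
    rw [integral_finsetSum _ fun c' _ => hi c c']
    refine Finset.sum_congr rfl fun c' _ => ?_
    rw [integral_const_mul, integral_indicator_one (hm c c')]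
  have hlim : Tendsto (fun N : ℕ => ∑ c ∈ s, ∑ c' ∈ s, |c * c'| * ((∑ n ∈ Finset.Icc 1 N,
      |μ.real (E c ∩ T^[n] ⁻¹' E c') - μ.real (E c) * μ.real (E c')|) / (N : ℝ)))
      atTop (𝓝 0) := by
    rw [show (0 : ℝ) = ∑ c ∈ s, ∑ c' ∈ s, |c * c'| * 0 by simp]
    exact tendsto_finsetSum _ fun c _ => tendsto_finsetSum _ fun c' _ =>
      (hmix _ _ (hEm c) (hEm c')).const_mul _
  refine squeeze_zero (fun N => by positivity) (fun N => ?_) hlim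
  simp_rw [← mul_div_assoc, ← Finset.sum_div]
  refine div_le_div_of_nonneg_right ?_ (by positivity)
  simp_rw [Finset.mul_sum]
  rw [Finset.sum_congr rfl fun c _ => Finset.sum_comm, Finset.sum_comm]
  refine Finset.sum_le_sum fun n _ => ?_
  rw [hcor, hint, Finset.sum_mul_sum, ← Finset.sum_sub_distrib]
  refine (Finset.abs_sum_le_sum_abs _ _).trans <| Finset.sum_le_sum fun c _ => ?_
  rw [← Finset.sum_sub_distrib]
  refine (Finset.abs_sum_le_sum_abs _ _).trans <| Finset.sum_le_sum fun c' _ => ?_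
  rw [← abs_mul]
  exact le_of_eq (congrArg _ (by ring))

section Observable

variable {X : Type*} [TopologicalSpace X] {T : X → X} {x₀ : X}

/-- Up to a delay `k`, the values of `F` along `ℕ` are those of `φ` along the orbit of `x₀`, where
`φ` is continuous with finite range. The delay accommodates translates of `F` by negative
integers, which are needed because `T` is not assumed invertible; the values of `F` below `k` are
unconstrained. The finite range makes `φ` a simple function. -/
structure IsObservedBy (T : X → X) (x₀ : X) (F : ℤ →ᵇ ℝ) (k : ℕ) (φ : X → ℝ) : Prop where
  continuous : Continuous φ
  finite_range : (Set.range φ).Finite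
  apply_add : ∀ m : ℕ, F (m + k) = φ (T^[m] x₀)

namespace IsObservedBy

variable {F G : ℤ →ᵇ ℝ} {k l : ℕ} {φ ψ : X → ℝ}

theorem translate (hT : Continuous T) (hF : IsObservedBy T x₀ F k φ) {i : ℕ} {j : ℤ}
    (h : (l : ℤ) + j = k + i) : IsObservedBy T x₀ (shiftBy j F) l (φ ∘ T^[i]) where
  continuous := hF.continuous.comp (hT.iterate i)
  finite_range := hF.finite_range.subset (Set.range_comp_subset_range _ _)
  apply_add m := by
    rw [shiftBy_apply, add_assoc, h, Function.comp_apply, ← Function.iterate_add_apply,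
      add_comm i m, ← hF.apply_add]
    congr 1
    push_cast
    ring

theorem raise (hT : Continuous T) (hF : IsObservedBy T x₀ F k φ) (i : ℕ) :
    IsObservedBy T x₀ F (k + i) (φ ∘ T^[i]) := by
  have := hF.translate hT (l := k + i) (i := i) (j := 0) (by simp)
  have e : shiftBy 0 F = F := by ext m; simp [shiftBy_apply]
  rwa [e] at this

theorem map₂ {H : ℤ →ᵇ ℝ} {op : ℝ → ℝ → ℝ} (hop : Continuous fun z : ℝ × ℝ => op z.1 z.2)
    (hF : IsObservedBy T x₀ F k φ) (hG : IsObservedBy T x₀ G k ψ)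
    (hH : ∀ m, H m = op (F m) (G m)) : IsObservedBy T x₀ H k fun x => op (φ x) (ψ x) where
  continuous := hop.comp (hF.continuous.prodMk hG.continuous)
  finite_range := (hF.finite_range.image2 op hG.finite_range).subset <| by
    rintro _ ⟨x, rfl⟩
    exact ⟨_, ⟨x, rfl⟩, _, ⟨x, rfl⟩, rfl⟩
  apply_add m := by rw [hH, hF.apply_add, hG.apply_add]

theorem mul (hF : IsObservedBy T x₀ F k φ) (hG : IsObservedBy T x₀ G k ψ) :
    IsObservedBy T x₀ (F * G) k fun x => φ x * ψ x :=
  hF.map₂ continuous_mul hG fun _ => rfl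

theorem add (hF : IsObservedBy T x₀ F k φ) (hG : IsObservedBy T x₀ G k ψ) :
    IsObservedBy T x₀ (F + G) k fun x => φ x + ψ x :=
  hF.map₂ continuous_add hG fun _ => rfl

theorem tendsto_orbitAverage [MeasurableSpace X] {μ : Measure X}
    (hgen : IsErgodicGeneric T μ x₀) (hF : IsObservedBy T x₀ F k φ) :
    Tendsto (orbitAverage F) atTop (𝓝 (∫ x, φ x ∂μ)) := by
  have h1 : Tendsto (orbitAverage (shiftBy k F)) atTop (𝓝 (∫ x, φ x ∂μ)) := by
    refine (hgen ⟨φ, hF.continuous⟩).congr fun N => ?_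
    rw [sum_Icc_one_eq_sum_range, orbitAverage, inv_mul_eq_div]
    congr 1
    refine Finset.sum_congr rfl fun n _ => ?_
    rw [shiftBy_apply, ContinuousMap.coe_mk, ← hF.apply_add, Nat.cast_add, Nat.cast_one]
  have h2 := tendsto_orbitAverage_translate h1 (-k)
  have e : shiftBy (-k) (shiftBy k F) = F := by ext m; simp [shiftBy_apply]
  rwa [e] at h2

end IsObservedBy

/-- The algebra of bounded functions on `ℤ` that are observed along the orbit of `x₀`. -/
def observables (hT : Continuous T) (x₀ : X) : Subalgebra ℝ (ℤ →ᵇ ℝ) where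
  carrier := {F | ∃ k φ, IsObservedBy T x₀ F k φ}
  mul_mem' := by
    rintro F G ⟨k, φ, hF⟩ ⟨l, ψ, hG⟩
    exact ⟨_, _, (hF.raise hT l).mul (add_comm l k ▸ hG.raise hT k)⟩
  add_mem' := by
    rintro F G ⟨k, φ, hF⟩ ⟨l, ψ, hG⟩
    exact ⟨_, _, (hF.raise hT l).add (add_comm l k ▸ hG.raise hT k)⟩
  algebraMap_mem' c := ⟨0, fun _ => c, continuous_const,
    (Set.finite_singleton c).subset (by rintro _ ⟨x, rfl⟩; rfl),
    fun m => by simp [BoundedContinuousFunction.algebraMap_apply]⟩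

/-- Evaluation of observables at the integer `m`. -/
noncomputable def observablesEval (hT : Continuous T) (x₀ : X) (m : ℤ) :
    observables hT x₀ →ₐ[ℝ] ℝ where
  toFun F := F.1 m
  map_one' := rfl
  map_mul' _ _ := rfl
  map_zero' := rfl
  map_add' _ _ := rfl
  commutes' c := by simp [BoundedContinuousFunction.algebraMap_apply]

/-- Translation of observables by `k`. The result is observed with a longer delay if `k < 0`. -/
def observablesShift (hT : Continuous T) (x₀ : X) (k : ℤ) :
    observables hT x₀ →ₐ[ℝ] observables hT x₀ where
  toFun F := ⟨shiftBy k F.1, by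
    obtain ⟨l, φ, hF⟩ := F.2
    exact ⟨l + k.natAbs, _, hF.translate hT (i := (k + k.natAbs).toNat) (by omega)⟩⟩
  map_one' := rfl
  map_mul' _ _ := rfl
  map_zero' := rfl
  map_add' _ _ := rfl
  commutes' _ := rfl

variable [MeasurableSpace X] {μ : Measure X}

theorem exists_tendsto_orbitAverage {hT : Continuous T} (hgen : IsErgodicGeneric T μ x₀)
    (F : observables hT x₀) : ∃ L, Tendsto (orbitAverage F.1) atTop (𝓝 L) := by
  obtain ⟨k, φ, hF⟩ := F.2
  exact ⟨_, hF.tendsto_orbitAverage hgen⟩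

/-- The limit of the averages of an observable over the integers from `1` to `N`. -/
noncomputable def observablesMean (hT : Continuous T) (hgen : IsErgodicGeneric T μ x₀) :
    observables hT x₀ →ₗ[ℝ] ℝ where
  toFun F := (exists_tendsto_orbitAverage hgen F).choose
  map_add' F G := by
    have hF := (exists_tendsto_orbitAverage hgen F).choose_spec
    have hG := (exists_tendsto_orbitAverage hgen G).choose_spec
    have hFG := (exists_tendsto_orbitAverage hgen (F + G)).choose_spec
    refine tendsto_nhds_unique hFG ((hF.add hG).congr fun N => ?_)
    simp only [orbitAverage, ← mul_add, ← Finset.sum_add_distrib]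
    rfl
  map_smul' c F := by
    have hF := (exists_tendsto_orbitAverage hgen F).choose_spec
    have hcF := (exists_tendsto_orbitAverage hgen (c • F)).choose_spec
    refine tendsto_nhds_unique hcF ((hF.const_mul c).congr fun N => ?_)
    simp only [orbitAverage, mul_left_comm c, Finset.mul_sum]
    rfl

theorem tendsto_observablesMean {hT : Continuous T} (hgen : IsErgodicGeneric T μ x₀)
    (F : observables hT x₀) :
    Tendsto (orbitAverage F.1) atTop (𝓝 (observablesMean hT hgen F)) :=
  (exists_tendsto_orbitAverage hgen F).choose_spec

/-- The observables along the orbit of a generic point of a weakly mixing measure form a mixing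
system. -/
noncomputable def observablesSystem [BorelSpace X] [IsProbabilityMeasure μ]
    (hT : Continuous T) (hgen : IsErgodicGeneric T μ x₀)
    (hmix : IsWeaklyMixing T μ) : MixingSystem (observables hT x₀) where
  shift := observablesShift hT x₀
  mean := observablesMean hT hgen
  shift_zero F := by
    ext m
    change F.1 (m + 0) = F.1 m
    rw [add_zero]
  shift_add k l F := by
    ext m
    change F.1 (m + (k + l)) = F.1 (m + k + l)
    rw [add_assoc]
  norm_shift_le k F := by
    change ‖shiftBy k F.1‖ ≤ ‖F.1‖
    exact (BoundedContinuousFunction.norm_le (norm_nonneg _)).2 fun m => F.1.norm_coe_le_norm _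
  mean_one := by
    refine tendsto_nhds_unique (tendsto_observablesMean hgen 1)
      (tendsto_const_nhds.congr' ?_)
    filter_upwards [eventually_gt_atTop 0] with N hN
    have hN' : (N : ℝ) ≠ 0 := by exact_mod_cast hN.ne'
    simp [orbitAverage, hN']
  mean_shift k F := tendsto_nhds_unique (tendsto_observablesMean hgen _)
    (tendsto_orbitAverage_translate (tendsto_observablesMean hgen F) k)
  mean_mul_self_nonneg F := by
    refine ge_of_tendsto' (tendsto_observablesMean hgen (F * F)) fun N => ?_
    exact mul_nonneg (by positivity) (Finset.sum_nonneg fun n _ => mul_self_nonneg _)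
  abs_mean_le F := by
    refine le_of_tendsto (tendsto_observablesMean hgen F).abs ?_
    filter_upwards [eventually_gt_atTop 0] with N hN
    have hN' : (0 : ℝ) < N := by exact_mod_cast hN
    rw [orbitAverage, abs_mul, abs_of_pos (inv_pos.2 hN'), inv_mul_le_iff₀ hN']
    have h := norm_sum_le_of_le (Finset.range N)
      (f := fun n : ℕ => F.1 ((n : ℤ) + 1)) fun n _ => F.1.norm_coe_le_norm _
    rw [Finset.sum_const, Finset.card_range, nsmul_eq_mul] at h
    exact h
  tendsto_correlation F hF := by
    obtain ⟨k, φ, hφ⟩ := F.2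
    have h0 : ∫ x, φ x ∂μ = 0 := by
      rw [← hF]
      exact tendsto_nhds_unique (hφ.tendsto_orbitAverage hgen) (tendsto_observablesMean hgen F)
    have hc : ∀ h : ℕ, observablesMean hT hgen (F * observablesShift hT x₀ h F) =
        ∫ x, φ x * φ (T^[h] x) ∂μ := fun h =>
      tendsto_nhds_unique (tendsto_observablesMean hgen _)
        ((hφ.mul (hφ.translate hT (j := h) rfl)).tendsto_orbitAverage hgen)
    have h1 := hmix.tendsto_correlation hT.measurable hφ.continuous.measurable hφ.finite_range
    simp only [hc]
    simp only [h0, mul_zero, sub_zero] at h1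
    set c : ℕ → ℝ := fun h => |∫ x, φ x * φ (T^[h] x) ∂μ|
    have h2 := (((tendsto_inv_atTop_nhds_zero_nat (𝕜 := ℝ)).mul_const (c 0))).add h1
    rw [zero_mul, zero_add] at h2
    refine squeeze_zero (fun H => by positivity) (fun H => ?_) h2
    rw [div_eq_inv_mul, ← mul_add]
    refine mul_le_mul_of_nonneg_left ?_ (by positivity)
    rw [sum_Icc_one_eq_sum_range, add_comm, ← Finset.sum_range_succ' c]
    exact Finset.sum_le_sum_of_subset_of_nonneg (Finset.range_subset_range.2 (by omega))
      fun _ _ _ => abs_nonneg _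

end Observable

/-! ### Patterns in weakly mixing sets -/

open Classical in
/-- The characteristic function of `A`, extended by zero to all integers. -/
noncomputable def indicatorInt (A : Set ℕ+) : ℤ →ᵇ ℝ :=
  BoundedContinuousFunction.ofNormedAddCommGroupDiscrete
    (fun m : ℤ => if ∃ a ∈ A, m = ((a : ℕ) : ℤ) then 1 else 0) 1
    (fun m => by split_ifs <;> simp)

open Classical in
theorem indicatorInt_apply (A : Set ℕ+) (m : ℤ) :
    indicatorInt A m = if ∃ a ∈ A, m = ((a : ℕ) : ℤ) then 1 else 0 := rfl

open Classical in
theorem indicatorInt_apply_succ (A : Set ℕ+) (n : ℕ) :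
    indicatorInt A ((n : ℤ) + 1) = if n.succPNat ∈ A then 1 else 0 := by
  rw [indicatorInt_apply]
  congr 1
  refine propext ⟨?_, fun h => ⟨_, h, by simp⟩⟩
  rintro ⟨a, ha, h⟩
  have : a = n.succPNat := PNat.eq (by simp; omega)
  exact this ▸ ha

theorem orbitAverage_indicatorInt (A : Set ℕ+) :
    orbitAverage (indicatorInt A) = densityUpTo A := by
  classical
  ext N
  have e : {a ∈ A | (a : ℕ) ≤ N} =
      ((Finset.range N).filter fun n => n.succPNat ∈ A).image Nat.succPNat := by
    ext a
    simp only [Set.mem_ofPred_eq, Finset.coe_image, Finset.coe_filter, Finset.mem_range,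
      Set.mem_image]
    constructor
    · rintro ⟨ha, haN⟩
      refine ⟨a.natPred, ⟨?_, by rwa [PNat.succPNat_natPred]⟩, PNat.succPNat_natPred a⟩
      have := a.natPred_add_one
      omega
    · rintro ⟨n, ⟨hn, hA⟩, rfl⟩
      exact ⟨hA, by rw [Nat.succPNat_coe]; omega⟩
  rw [orbitAverage, densityUpTo, e, Set.ncard_coe_finset,
    Finset.card_image_of_injective _ Nat.succPNat_injective, inv_mul_eq_div]
  simp only [indicatorInt_apply_succ, Finset.sum_boole]

theorem iterate_subshiftMap_apply (A : Set ℕ+) (m : ℕ) (y : subshift A) (i : ℕ+) :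
    ((subshiftMap A)^[m] y).1 i = y.1 ⟨i + m, by positivity⟩ := by
  induction m generalizing y with
  | zero => rfl
  | succ m ih =>
    rw [Function.iterate_succ_apply, ih]
    change y.1 (_ + 1) = _
    congr 1

theorem continuous_subshiftMap (A : Set ℕ+) : Continuous (subshiftMap A) :=
  continuous_shiftMap.restrict _

theorem isObservedBy_indicatorInt (A : Set ℕ+) :
    IsObservedBy (subshiftMap A) ⟨charPoint A, charPoint_mem_subshift A⟩ (indicatorInt A) 1
      fun y => if y.1 1 then 1 else 0 where
  continuous := by
    have h : Continuous fun b : Bool => if b then (1 : ℝ) else 0 := continuous_of_discreteTopology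
    exact h.comp ((continuous_apply 1).comp continuous_subtype_val)
  finite_range := (Set.toFinite {0, 1}).subset <| by
    rintro _ ⟨y, rfl⟩
    dsimp only
    split_ifs <;> simp
  apply_add m := by
    rw [iterate_subshiftMap_apply, Nat.cast_one, indicatorInt_apply_succ]
    have : (⟨((1 : ℕ+) : ℕ) + m, by positivity⟩ : ℕ+) = m.succPNat :=
      PNat.eq (by simp [add_comm])
    rw [this]
    by_cases h : m.succPNat ∈ A <;> simp [charPoint, h]

theorem IsUniformlyAdmissible.exists_isAdmissible {r : ℕ} {p : Fin r → ℕ+ → ℤ[X]}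
    (hp : IsUniformlyAdmissible p) :
    ∃ cls, IsAdmissible (fun i (N : ℕ) => p i N.toPNat') cls := by
  refine ⟨fun i => ((p i 1).natDegree, (p i 1).leadingCoeff), fun i => ⟨?_, fun N => ?_⟩,
    fun i => hp.natDegree_pos i 1, fun i j hij =>
      ⟨((p i 1 - p j 1).natDegree, (p i 1 - p j 1).leadingCoeff),
        hp.natDegree_sub_pos i j hij 1, ?_, fun N => ?_⟩⟩
  · exact (hp.leadingCoeff_pos i 1).ne'
  · rw [hp.natDegree_eq i 1 N.toPNat', hp.leadingCoeff_eq i 1 N.toPNat']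
    exact ⟨le_rfl, rfl⟩
  · intro h
    have := hp.natDegree_sub_pos i j hij 1
    have h0 : p i 1 - p j 1 = 0 := leadingCoeff_eq_zero.1 h
    rw [h0, natDegree_zero] at this
    exact this.false
  · rw [hp.natDegree_sub_eq i j hij 1 N.toPNat', hp.leadingCoeff_sub_eq i j hij 1 N.toPNat']
    exact ⟨le_rfl, rfl⟩

theorem theorem1p7 (A B : Set ℕ+) (hA : IsWeaklyMixingSet A) (hB : HasPosDensity B)
    (r : ℕ) (p : Fin r → ℕ+ → ℤ[X]) (hp : IsUniformlyAdmissible p) :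
    ∃ N₀ : ℕ+, ∀ N : ℕ+, N₀ < N →
      ∃ n : ℕ+, n ≤ N ∧ ∃ m ∈ B, ∀ i : Fin r, ∃ a ∈ A,
        (p i N).eval ((n : ℕ) : ℤ) + ((m : ℕ) : ℤ) = ((a : ℕ) : ℤ) := by
  classical
  obtain ⟨hdens, μ, hμ, -, hgen, hmix⟩ := hA
  obtain ⟨β, hβ, hB⟩ := hB
  set hT := continuous_subshiftMap A
  set W := observablesSystem hT hgen hmix with hW
  let f : observables hT _ := ⟨indicatorInt A, 1, _, isObservedBy_indicatorInt A⟩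
  have hf : 0 < W.mean f := by
    have h : Tendsto (densityUpTo A) atTop (𝓝 (W.mean f)) :=
      orbitAverage_indicatorInt A ▸ tendsto_observablesMean hgen f
    rw [upperNatDensity, h.limsup_eq] at hdens
    exact hdens
  set d := W.mean f with hd
  obtain ⟨cls, hcls⟩ := hp.exists_isAdmissible
  have hnull := W.isNull_deviation hcls fun _ => f
  obtain ⟨N₀, hN₀⟩ := eventually_atTop.1 <|
    Tendsto.eventually_lt_const (u := (d ^ r) ^ 2 * β) (by positivity) hnull
  refine ⟨N₀.toPNat', fun N hN => ?_⟩
  have hNN : N₀ ≤ (N : ℕ) := by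
    have h1 : (N₀.toPNat' : ℕ) < N := hN
    rw [Nat.toPNat'_coe] at h1
    split_ifs at h1 <;> omega
  have hlt := hN₀ N hNN
  by_contra! hno
  set x := W.deviation (fun i (N : ℕ) => p i N.toPNat') (fun _ => f) N with hx
  refine absurd hlt (not_lt.2 ?_)
  -- If there is no solution, every product vanishes at the points of `B`, so that the deviation is
  -- `-d ^ r` there, and its mean square is at least `d ^ (2 * r)` times the density of `B`.
  have hval : ∀ m ∈ B, x.1 ((m : ℕ) : ℤ) = -d ^ r := by
    intro m hm
    change observablesEval hT _ ((m : ℕ) : ℤ) x = _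
    have hz : ∀ n, observablesEval hT ⟨charPoint A, charPoint_mem_subshift A⟩ ((m : ℕ) : ℤ)
        (W.prodShift (fun i (N : ℕ) => p i N.toPNat') (fun _ => f) N n) = 0 ∨ N ≤ n := by
      intro n
      by_cases hn : N ≤ n
      · exact Or.inr hn
      left
      obtain ⟨i, hi⟩ := hno n.succPNat (by
        rw [← PNat.coe_le_coe, Nat.succPNat_coe]; omega) m hm
      rw [MixingSystem.prodShift, map_prod]
      refine Finset.prod_eq_zero (Finset.mem_univ i) ?_
      change indicatorInt A (((m : ℕ) : ℤ) + _) = 0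
      rw [indicatorInt_apply, if_neg]
      rintro ⟨a, ha, h⟩
      refine hi a ha ?_
      rw [← h, add_comm]
      simp
    rw [hx, MixingSystem.deviation, map_sub, map_smul, map_sum, AlgHom.commutes,
      Finset.sum_eq_zero fun n hn => (hz n).resolve_right (by
        have := Finset.mem_range.1 hn; omega)]
    simp [← hd]
  refine le_of_tendsto_of_tendsto' (hB.const_mul _) (tendsto_observablesMean hgen (x * x))
    fun M => ?_
  rw [← orbitAverage_indicatorInt, orbitAverage, orbitAverage, mul_left_comm, Finset.mul_sum]
  refine mul_le_mul_of_nonneg_left (Finset.sum_le_sum fun n _ => ?_) (by positivity)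
  rw [indicatorInt_apply_succ]
  change _ ≤ x.1 ((n : ℤ) + 1) * x.1 ((n : ℤ) + 1)
  split_ifs with hn
  · have h := hval _ hn
    rw [Nat.succPNat_coe, Nat.cast_succ] at h
    rw [h]
    exact le_of_eq (by ring)
  · rw [mul_zero]
    exact mul_self_nonneg _
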